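/- Let $\mathbf{k}$ be a field and let $\mathfrak{g}=\operatorname{Spec}(H)$ be a finite group scheme over $\mathbf{k}$, where $H$ is a finite-dimensional commutative Hopf algebra over $\mathbf{k}$ with comultiplication $\mu$ and counit $\pi$. A $\mathfrak{g}$-field is a field extension $K$ of $\mathbf{k}$ together with an action of $\mathfrak{g}$ on $\operatorname{Spec}(K)$, that is, a $\mathbf{k}$-algebra map $\partial: K\to K\otimes_{\mathbf{k}}H$ such that $(\mathrm{id}\otimes\pi)\circ\partial=\mathrm{id}_K$ and $(\mathrm{id}\otimes\mu)\circ\partial=(\partial\otimes\mathrm{id})\circ\partial$. Its field of constants is $K^{\mathfrak{g}}=\{x\in K \mid \partial(x)=x\otimes 1\}$. Fix a $\mathbf{k}$-basis $b_0,\dots,b_{e-1}$ of $H$ with $\pi(b_0)=1$ and $\pi(b_i)=0$ for $i>0$, and write $\partial(x)=\sum_{i<e}\partial_i(x)\otimes b_i$. We regard a $\mathfrak{g}$-field as a first-order structure in the language of rings expanded by unary function symbols for $\partial_1,\dots,\partial_{e-1}$ and by constant symbols for the elements of $\mathbf{k}$. A $\mathfrak{g}$-field $K$ is existentially closed if every quantifier-free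 formula over $K$ in finitely many variables which has a realisation in some $\mathfrak{g}$-field extension of $K$ has a realisation in $K$. If $K$ is an existentially closed $\mathfrak{g}$-field, then: 1. the field $K^{\mathfrak{g}}$ is pseudo-algebraically closed (PAC), that is, each absolutely irreducible variety over $K^{\mathfrak{g}}$ (an affine variety given by an ideal of $K^{\mathfrak{g}}[X_1,\dots,X_n]$, for some $n$, which generates a prime ideal over the algebraic closure of $K^{\mathfrak{g}}$) has a $K^{\mathfrak{g}}$-rational point; 2. the field $K^{\mathfrak{g}}$ is bounded, that is, its absolute Galois group $\operatorname{Gal}\big((K^{\mathfrak{g}})^{\mathrm{sep}}/K^{\mathfrak{g}}\big)$ is small: for every $n\geqslant 1$ it has only finitely many open subgroups of index $n$. -/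

import Mathlib

open scoped TensorProduct

universe u v w

namespace FiniteGroupScheme

noncomputable section

/-- An action on `Spec R` of the affine group scheme `Spec H` over `k`, given by a `k`-algebra map
`∂ : R → R ⊗ H` that satisfies the counit and the coassociativity condition. -/
structure Action (k : Type v) (H : Type w) [Field k] [CommRing H] [HopfAlgebra k H]
    (R : Type u) [CommRing R] [Algebra k R] where
  /-- the coaction `∂ : R → R ⊗ H` -/
  hom : R →ₐ[k] R ⊗[k] H
  counit_comp :
    ((Algebra.TensorProduct.rid k k R).toAlgHom.comp
      (Algebra.TensorProduct.map (AlgHom.id k R) (Bialgebra.counitAlgHom k H))).comp hom =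
        AlgHom.id k R
  coassoc :
    (Algebra.TensorProduct.map (AlgHom.id k R) (Bialgebra.comulAlgHom k H)).comp hom =
      ((Algebra.TensorProduct.assoc k k k R H H).toAlgHom.comp
        (Algebra.TensorProduct.map hom (AlgHom.id k H))).comp hom

section

variable {k : Type v} {H : Type w} [Field k] [CommRing H] [HopfAlgebra k H]

/-- `(K, actK) ⊆ (L, actL)` is an extension of fields with an action of `Spec H`: the square formed
by the two coactions and the inclusion `K → L` commutes. -/
def IsExtension {K L : Type u} [Field K] [Algebra k K] [Field L] [Algebra k L]
    [Algebra K L] [IsScalarTower k K L] (actK : Action k H K) (actL : Action k H L) : Prop :=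
  ∀ x : K, actL.hom (algebraMap K L x) =
    Algebra.TensorProduct.map (IsScalarTower.toAlgHom k K L) (AlgHom.id k H) (actK.hom x)

/-- The field of constants `{x ∈ K | ∂ x = x ⊗ 1}`. -/
def constants {K : Type u} [Field K] [Algebra k K] (act : Action k H K) :
    IntermediateField k K where
  __ := AlgHom.equalizer act.hom (Algebra.TensorProduct.includeLeft : K →ₐ[k] K ⊗[k] H)
  inv_mem' := by
    intro x hx
    change act.hom x⁻¹ = (Algebra.TensorProduct.includeLeft : K →ₐ[k] K ⊗[k] H) x⁻¹
    replace hx : act.hom x = (Algebra.TensorProduct.includeLeft : K →ₐ[k] K ⊗[k] H) x := hx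
    rcases eq_or_ne x 0 with rfl | h0
    · simp
    · have h1 : act.hom x⁻¹ * act.hom x = 1 := by
        rw [← map_mul, inv_mul_cancel₀ h0, map_one]
      have h2 : act.hom x * (Algebra.TensorProduct.includeLeft : K →ₐ[k] K ⊗[k] H) x⁻¹ = 1 := by
        rw [hx, ← map_mul, mul_inv_cancel₀ h0, map_one]
      exact left_inv_eq_right_inv h1 h2

/-- The `i`-th coordinate `∂ᵢ : R → R` of the coaction with respect to a `k`-basis of `H`, so that
`∂ r = ∑ i, ∂ᵢ r ⊗ bᵢ`. -/
def Action.op {R : Type u} [CommRing R] [Algebra k R] {ι : Type*}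
    (act : Action k H R) (b : Module.Basis ι k H) (i : ι) (r : R) : R :=
  (Algebra.TensorProduct.basis R b).repr (act.hom r) i

end

/-- The function symbols: those of rings, a constant symbol for each element of `k`, and `n` unary
symbols. -/
inductive Func (k : Type v) (n : ℕ) : ℕ → Type v
  | zero : Func k n 0
  | one : Func k n 0
  | neg : Func k n 1
  | add : Func k n 2
  | mul : Func k n 2
  | const (c : k) : Func k n 0
  | op (i : Fin n) : Func k n 1

/-- The language of rings expanded by constants for the elements of `k` and by `n` unary function
symbols; there are no relation symbols besides equality. -/
def language (k : Type v) (n : ℕ) : FirstOrder.Language where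
  Functions := Func k n
  Relations := fun _ => Empty

section

variable {k : Type v} {H : Type w} [Field k] [CommRing H] [HopfAlgebra k H]

/-- A ring with an action of `Spec H` as a first-order structure, with respect to a basis
`b₀, …, bₙ` of `H`: the unary symbols are interpreted as `∂₁, …, ∂ₙ`. -/
@[reducible]
def Action.toStructure {R : Type u} [CommRing R] [Algebra k R] {n : ℕ}
    (act : Action k H R) (b : Module.Basis (Fin (n + 1)) k H) : (language k n).Structure R where
  funMap := fun f => match f with
    | .zero => fun _ => 0
    | .one => fun _ => 1
    | .neg => fun x => -x 0
    | .add => fun x => x 0 + x 1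
    | .mul => fun x => x 0 * x 1
    | .const c => fun _ => algebraMap k R c
    | .op i => fun x => act.op b i.succ (x 0)
  RelMap := fun r => r.elim

/-- Satisfaction in `(R, act)` of a formula with free variables in `α`. -/
def Action.Realize {R : Type u} [CommRing R] [Algebra k R] {n : ℕ} {α : Type*}
    (act : Action k H R) (b : Module.Basis (Fin (n + 1)) k H)
    (φ : (language k n).Formula α) (x : α → R) : Prop :=
  letI := act.toStructure b
  φ.Realize x

/-- `(K, actK)` is existentially closed among the fields with an action of `Spec H`: every
quantifier-free formula over `K` (a formula whose variables are the elements of `K`, standing for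
themselves, and `x₁, …, xₘ`) that has a realisation in some extension `(L, actL)` has one in
`(K, actK)`. -/
def IsExistentiallyClosed {K : Type u} [Field K] [Algebra k K] {n : ℕ}
    (actK : Action k H K) (b : Module.Basis (Fin (n + 1)) k H) : Prop :=
  ∀ (L : Type u) [Field L] [Algebra k L] [Algebra K L] [IsScalarTower k K L]
    (actL : Action k H L), IsExtension actK actL →
    ∀ (m : ℕ) (φ : (language k n).Formula (K ⊕ Fin m)), φ.IsQF →
      (∃ y : Fin m → L, actL.Realize b φ (Sum.elim (algebraMap K L) y)) →
      ∃ x : Fin m → K, actK.Realize b φ (Sum.elim id x)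

end

/-- A field `M` is pseudo-algebraically closed if each absolutely irreducible affine variety over
`M` has an `M`-rational point. Such a variety in affine `n`-space is given by an ideal of
`M[X₁, …, Xₙ]` which generates a prime ideal over the algebraic closure of `M`. -/
def IsPAC (M : Type u) [Field M] : Prop :=
  ∀ (n : ℕ) (I : Ideal (MvPolynomial (Fin n) M)),
    (I.map (MvPolynomial.map (σ := Fin n) (algebraMap M (AlgebraicClosure M)))).IsPrime →
    ∃ a : Fin n → M, ∀ f ∈ I, MvPolynomial.eval a f = 0

/-- A profinite group is small if it has only finitely many open subgroups of each finite index. -/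
def IsSmall (G : Type u) [Group G] [TopologicalSpace G] : Prop :=
  ∀ n : ℕ, 0 < n → {U : Subgroup G | IsOpen (U : Set G) ∧ U.index = n}.Finite

/-- A field is bounded if its absolute Galois group, with the Krull topology, is small. -/
def IsBoundedField (M : Type u) [Field M] : Prop :=
  IsSmall (SeparableClosure M ≃ₐ[M] SeparableClosure M)

end

end FiniteGroupScheme

/-! Write C for the field of constants of K. First, K is finite over C
(`finiteDimensional_constants`): an Artin-style shortest-relation argument shows that ∂ sends a
C-independent family to a K-independent family in K ⊗ H, which is finite-dimensional. Secondly, for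
a C-algebra B the ring K ⊗_C B carries the action that is trivial on B. If this ring is a field, it
extends K, and the image of B consists of constants. Since constancy is a quantifier-free condition,
every polynomial system over C with a solution in B has one in C
(`exists_solution_of_isField_tensorProduct`). Both claims come down to a choice of B.

PAC: let B be the function field of the variety. Absolute irreducibility makes K ⊗ B a domain, and
it is a field because K is algebraic over C.

Boundedness: let B = C[X]/(f) with f separable and irreducible over K; then f has a root in C. Let N
be the Galois closure, in the separable closure of C, of the maximal separable subextension of K/C.
It follows that N ∩ C(α) = C forces α ∈ C. Hence coset representatives of the open subgroup fixing N
generate the Galois group topologically (`isBoundedField_of_irreducible`), and a topologically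
finitely generated group is small (`isSmall_of_dense_closure`). -/

namespace FiniteGroupScheme

noncomputable section

/-! ### Finiteness of K over its constants -/

section FiniteOverConstants

variable (k : Type v) (H : Type w) [Field k] [CommRing H] [HopfAlgebra k H]

/-- The algebra map `g ⊗ h ↦ g S(h₁) ⊗ h₂`, an inverse of `g ⊗ h ↦ g h₁ ⊗ h₂`. -/
def untwist : H ⊗[k] H →ₐ[k] H ⊗[k] H :=
  Algebra.TensorProduct.lift Algebra.TensorProduct.includeLeft
    ((Algebra.TensorProduct.map (HopfAlgebra.antipodeAlgHom k H) (AlgHom.id k H)).comp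
      (Bialgebra.comulAlgHom k H)) (fun _ _ => Commute.all _ _)

/-- By coassociativity the left side is h₁ S(h₂) ⊗ h₃, and the antipode axiom collapses the first
factor to a counit. -/
theorem untwist_comul (h : H) : untwist k H (Coalgebra.comul (R := k) h) = 1 ⊗ₜ h := by
  have key : ∀ z : H ⊗[k] H, untwist k H z =
      ((LinearMap.mul' k H).rTensor H ∘ₗ ((HopfAlgebra.antipode k (A := H)).lTensor H).rTensor H ∘ₗ
        (TensorProduct.assoc k H H H).symm.toLinearMap ∘ₗ
          (Coalgebra.comul (R := k) (A := H)).lTensor H) z := by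
    intro z
    induction z with
    | zero => simp
    | add x y hx hy => rw [map_add, map_add, hx, hy]
    | tmul g h =>
      simp only [untwist, Algebra.TensorProduct.lift_tmul, AlgHom.comp_apply,
        Bialgebra.comulAlgHom_apply, LinearMap.comp_apply, LinearMap.lTensor_tmul,
        Algebra.TensorProduct.includeLeft_apply]
      induction Coalgebra.comul (R := k) h with
      | zero => simp
      | add x y hx hy => simp only [map_add, mul_add, TensorProduct.tmul_add, hx, hy]
      | tmul x y => simp
  rw [key]
  simp only [LinearMap.comp_apply]
  rw [LinearEquiv.coe_coe, Coalgebra.coassoc_symm_apply, ← LinearMap.comp_apply,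
    ← LinearMap.comp_apply, ← LinearMap.rTensor_comp, ← LinearMap.rTensor_comp, LinearMap.comp_assoc,
    HopfAlgebra.mul_antipode_lTensor_comul]
  rw [LinearMap.rTensor_comp, LinearMap.comp_apply, Coalgebra.rTensor_counit_comul]
  simp

variable {k H} {K : Type u} [Field K] [Algebra k K]

theorem Action.hom_injective (act : Action k H K) : Function.Injective act.hom := by
  intro x y h
  have hx := DFunLike.congr_fun act.counit_comp x
  have hy := DFunLike.congr_fun act.counit_comp y
  rw [AlgHom.comp_apply] at hx hy
  exact hx.symm.trans ((congrArg _ h).trans hy)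

/-- The relation `∑ aᵢ ∂(vᵢ) = 0` is inherited by the coordinates of the `∂ aᵢ`. -/
theorem sum_coord_mul_hom_eq_zero (act : Action k H K) {ι κ : Type*} (b : Module.Basis κ k H)
    (j : κ) (s : Finset ι) (a v : ι → K) (h : ∑ i ∈ s, (a i ⊗ₜ[k] (1 : H)) * act.hom (v i) = 0) :
    ∑ i ∈ s, (act.op b j (a i) ⊗ₜ[k] (1 : H)) * act.hom (v i) = 0 := by
  -- `G` applies ∂ to the K-factor and then untwists. By coassociativity ∂(vᵢ) just moves to the
  -- last slot, while aᵢ ⊗ 1 becomes ∂(aᵢ) in the first two; `E` then reads off the j-th coordinate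
  -- in the middle slot.
  let G : K ⊗[k] H →ₐ[k] K ⊗[k] (H ⊗[k] H) :=
    (Algebra.TensorProduct.map (AlgHom.id k K) (untwist k H)).comp
      ((Algebra.TensorProduct.assoc k k k K H H).toAlgHom.comp
        (Algebra.TensorProduct.map act.hom (AlgHom.id k H)))
  let iL : K ⊗[k] H →ₐ[k] K ⊗[k] (H ⊗[k] H) :=
    Algebra.TensorProduct.map (AlgHom.id k K) Algebra.TensorProduct.includeLeft
  let iR : K ⊗[k] H →ₐ[k] K ⊗[k] (H ⊗[k] H) :=
    Algebra.TensorProduct.map (AlgHom.id k K) Algebra.TensorProduct.includeRight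
  have hG : ∀ x : K, G (act.hom x) = iR (act.hom x) := by
    intro x
    have hc := congrArg (fun f => (Algebra.TensorProduct.map (AlgHom.id k K) (untwist k H)) (f x))
      act.coassoc
    simp only [AlgHom.comp_apply] at hc
    refine hc.symm.trans ?_
    rw [← AlgHom.comp_apply, ← Algebra.TensorProduct.map_comp]
    congr 2
    ext h
    exact untwist_comul k H h
  have hG1 : ∀ x : K, G (x ⊗ₜ 1) = iL (act.hom x) := by
    intro x
    simp only [G, AlgHom.comp_apply, Algebra.TensorProduct.map_tmul, map_one]
    induction act.hom x with
    | zero => simp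
    | add x y hx hy => rw [TensorProduct.add_tmul, map_add, map_add, map_add, hx, hy]
    | tmul x g => simp [iL, untwist]
  let E : K ⊗[k] (H ⊗[k] H) →ₗ[k] K ⊗[k] H :=
    ((TensorProduct.lid k H).toLinearMap ∘ₗ (b.coord j).rTensor H).lTensor K
  have hE : ∀ y z : K ⊗[k] H, E (iL y * iR z) =
      ((Algebra.TensorProduct.basis K b).repr y j ⊗ₜ[k] (1 : H)) * z := by
    intro y z
    induction y with
    | zero => simp
    | add x y hx hy => simp only [map_add, add_mul, hx, hy, Finsupp.add_apply,
        TensorProduct.add_tmul]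
    | tmul x g =>
      induction z with
      | zero => simp
      | add x y hx hy => simp only [map_add, mul_add, hx, hy]
      | tmul y h =>
        simp only [E, iL, iR, Algebra.TensorProduct.map_tmul, AlgHom.id_apply,
          Algebra.TensorProduct.includeLeft_apply, Algebra.TensorProduct.includeRight_apply,
          Algebra.TensorProduct.tmul_mul_tmul, mul_one, one_mul, LinearMap.lTensor_tmul,
          LinearMap.comp_apply, LinearMap.rTensor_tmul, Module.Basis.coord_apply,
          LinearEquiv.coe_coe, TensorProduct.lid_tmul, Algebra.TensorProduct.basis_repr_tmul,
          Finsupp.smul_apply, Finsupp.mapRange_apply, smul_eq_mul]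
        rw [mul_right_comm, mul_comm _ (algebraMap k K _), ← Algebra.smul_def,
          TensorProduct.smul_tmul]
  have := congrArg (fun x => E (G x)) h
  simpa only [Action.op, map_sum, map_mul, hG, hG1, hE, map_zero] using this

/-- Artin's argument: scale a relation so that one coefficient is 1. Taking coordinates of ∂ of the
coefficients and subtracting those of 1 gives shorter relations, trivial by induction. So all
coefficients are constants, and injectivity of ∂ yields a linear relation among the vᵢ over the
constants. -/
theorem eq_zero_of_sum_mul_hom_eq_zero (act : Action k H K) {ι : Type*} {v : ι → K}
    (hv : LinearIndependent (constants act) v) (s : Finset ι) (a : ι → K)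
    (h : ∑ i ∈ s, (a i ⊗ₜ[k] (1 : H)) * act.hom (v i) = 0) : ∀ i ∈ s, a i = 0 := by
  classical
  induction hs : s.card generalizing s a with
  | zero =>
    intro i hi
    rw [Finset.card_eq_zero.mp hs] at hi
    simp at hi
  | succ m ih =>
    by_contra! hne
    obtain ⟨i₀, hi₀, ha₀⟩ := hne
    let a' : ι → K := fun i => (a i₀)⁻¹ * a i
    have ha' : a' i₀ = 1 := inv_mul_cancel₀ ha₀
    have h' : ∑ i ∈ s, (a' i ⊗ₜ[k] (1 : H)) * act.hom (v i) = 0 := by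
      have := congrArg (fun x => ((a i₀)⁻¹ ⊗ₜ[k] (1 : H)) * x) h
      simpa only [Finset.mul_sum, ← mul_assoc, Algebra.TensorProduct.tmul_mul_tmul, one_mul,
        mul_zero] using this
    let b := Module.Free.chooseBasis k H
    have hconst : ∀ i ∈ s, act.hom (a' i) = a' i ⊗ₜ 1 := by
      intro i hi
      rcases eq_or_ne i i₀ with rfl | hii
      · rw [ha', map_one, Algebra.TensorProduct.one_def]
      refine (Algebra.TensorProduct.basis K b).ext_elem fun j => ?_
      -- The j-th coordinate of ∂(a'ᵢ) - a'ᵢ ⊗ 1; it vanishes at `i₀` because a' is 1 there.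
      let c : ι → K := fun i => act.op b j (a' i) - algebraMap k K (b.repr 1 j) * a' i
      have hc₀ : c i₀ = 0 := by
        simp only [c, ha', Action.op, map_one, Algebra.TensorProduct.one_def]
        simp [Algebra.TensorProduct.basis_repr_tmul]
      have hsum : ∑ i ∈ s, (c i ⊗ₜ[k] (1 : H)) * act.hom (v i) = 0 := by
        have h1 := sum_coord_mul_hom_eq_zero act b j s a' v h'
        have h2 := congrArg (fun x => (algebraMap k K (b.repr 1 j) ⊗ₜ[k] (1 : H)) * x) h'
        simp only [Finset.mul_sum, ← mul_assoc, Algebra.TensorProduct.tmul_mul_tmul, one_mul,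
          mul_zero] at h2
        simp only [c, TensorProduct.sub_tmul, sub_mul, Finset.sum_sub_distrib, h1, h2, sub_zero]
      have := ih (s.erase i₀) c
        (by rw [Finset.sum_erase _ (by simp [hc₀]), hsum])
        (by rw [Finset.card_erase_of_mem hi₀, hs]; rfl) i (Finset.mem_erase.mpr ⟨hii, hi⟩)
      have h3 := sub_eq_zero.mp this
      simp only [Action.op] at h3
      rw [h3]
      simp [Algebra.TensorProduct.basis_repr_tmul, mul_comm]
    let g : ι → constants act := fun i => if hi : i ∈ s then ⟨a' i, hconst i hi⟩ else 0
    have hg : ∀ i ∈ s, (g i : K) = a' i := fun i hi => by simp [g, hi]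
    have hlin : ∑ i ∈ s, g i • v i = 0 := by
      apply act.hom_injective
      rw [map_zero, map_sum, ← h']
      refine Finset.sum_congr rfl fun i hi => ?_
      rw [IntermediateField.smul_def, smul_eq_mul, hg i hi, map_mul, hconst i hi]
    have := linearIndependent_iff'.mp hv s g hlin i₀ hi₀
    have h1 := hg i₀ hi₀
    rw [this, ha'] at h1
    exact zero_ne_one h1

/-- A field with an action of a finite group scheme is finite over its constants. -/
theorem finiteDimensional_constants [Module.Finite k H] (act : Action k H K) :
    FiniteDimensional (constants act) K := by
  let B := Module.Free.chooseBasis (constants act) K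
  have hli : LinearIndependent K (fun i => act.hom (B i)) := by
    rw [linearIndependent_iff']
    intro s a h
    refine eq_zero_of_sum_mul_hom_eq_zero act B.linearIndependent s a ?_
    rw [← h]
    refine Finset.sum_congr rfl fun i _ => ?_
    rw [Algebra.smul_def]
    rfl
  have : Finite (Module.Free.ChooseBasisIndex (constants act) K) := hli.finite
  exact Module.Finite.of_basis B

end FiniteOverConstants

/-! ### Base change of an action along a trivial action -/

section BaseChange

variable {k : Type v} {H : Type w} [Field k] [CommRing H] [HopfAlgebra k H]
  {K : Type u} [CommRing K] [Algebra k K]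

/-- A `k`-algebra map `∂ : L → L ⊗ H` is an action if `L` is generated by constants and by the image
of a map `φ` that intertwines `∂` with an action. -/
def Action.ofAdjoin (act : Action k H K) {L : Type u} [CommRing L] [Algebra k L] (φ : K →ₐ[k] L)
    (T : Set L) (hom : L →ₐ[k] L ⊗[k] H)
    (hφ : ∀ x, hom (φ x) = Algebra.TensorProduct.map φ (AlgHom.id k H) (act.hom x))
    (hT : ∀ y ∈ T, hom y = y ⊗ₜ 1) (hgen : Algebra.adjoin k (Set.range φ ∪ T) = ⊤) :
    Action k H L where
  hom := hom
  counit_comp := by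
    refine AlgHom.ext_of_adjoin_eq_top hgen fun z hz => ?_
    rcases hz with ⟨x, rfl⟩ | hz
    · have := congrArg φ (DFunLike.congr_fun act.counit_comp x)
      rw [AlgHom.comp_apply] at this ⊢
      rw [hφ]
      refine Eq.trans ?_ this
      induction act.hom x with
      | zero => simp only [map_zero]
      | add x y hx hy => simp only [map_add, hx, hy]
      | tmul x y => simp
    · rw [AlgHom.comp_apply, hT z hz]
      simp
  coassoc := by
    refine AlgHom.ext_of_adjoin_eq_top hgen fun z hz => ?_
    rcases hz with ⟨x, rfl⟩ | hz
    · have := congrArg (Algebra.TensorProduct.map φ (AlgHom.id k (H ⊗[k] H)))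
        (DFunLike.congr_fun act.coassoc x)
      rw [AlgHom.comp_apply, AlgHom.comp_apply] at this ⊢
      rw [hφ]
      refine Eq.trans ?_ (this.trans ?_)
      · induction act.hom x with
        | zero => simp only [map_zero]
        | add x y hx hy => simp only [map_add, hx, hy]
        | tmul x y => simp
      · induction act.hom x with
        | zero => simp only [map_zero]
        | add x y hx hy => simp only [map_add, hx, hy]
        | tmul x h =>
          simp only [AlgHom.comp_apply, Algebra.TensorProduct.map_tmul, hφ, AlgHom.id_apply]
          induction act.hom x with
          | zero => simp
          | add x y hx hy => simp only [map_add, TensorProduct.add_tmul, hx, hy]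
          | tmul x y => simp
    · rw [AlgHom.comp_apply, AlgHom.comp_apply, hT z hz]
      simp [hT z hz, Algebra.TensorProduct.one_def]

variable (act : Action k H K) (C : Type u) [Field C] [Algebra k C] [Algebra C K]
  [IsScalarTower k C K] (hC : ∀ c : C, act.hom (algebraMap C K c) = algebraMap C K c ⊗ₜ 1)
  (B : Type u) [CommRing B] [Algebra C B]

/-- The coaction is linear over a field of constants. -/
def Action.homOver : K →ₐ[C] K ⊗[k] H where
  __ := act.hom.toRingHom
  commutes' x := hC x

/-- The coaction on `K ⊗ B`, for an algebra `B` over a field of constants of `K` on which the group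
scheme acts trivially. -/
def baseChangeHom : K ⊗[C] B →ₐ[k] (K ⊗[C] B) ⊗[k] H :=
  (Algebra.TensorProduct.lift
    ((Algebra.TensorProduct.map (R := k) (S := C)
      (Algebra.TensorProduct.includeLeft : K →ₐ[C] K ⊗[C] B)
      (AlgHom.id k H)).comp (act.homOver C hC))
    ((Algebra.TensorProduct.includeLeft : K ⊗[C] B →ₐ[C] (K ⊗[C] B) ⊗[k] H).comp
      Algebra.TensorProduct.includeRight)
    (fun _ _ => Commute.all _ _)).restrictScalars k

theorem baseChangeHom_tmul_one (x : K) : baseChangeHom act C hC B (x ⊗ₜ 1) =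
    Algebra.TensorProduct.map (IsScalarTower.toAlgHom k K (K ⊗[C] B)) (AlgHom.id k H)
      (act.hom x) := by
  simp only [baseChangeHom, AlgHom.restrictScalars_apply, Algebra.TensorProduct.lift_tmul, map_one,
    mul_one, AlgHom.comp_apply]
  change _ = (Algebra.TensorProduct.map (IsScalarTower.toAlgHom k K (K ⊗[C] B))
    (AlgHom.id k H)) (act.homOver C hC x)
  induction act.homOver C hC x with
  | zero => simp
  | add x y hx hy => rw [map_add, map_add, hx, hy]
  | tmul x y => rfl

theorem baseChangeHom_one_tmul (y : B) : baseChangeHom act C hC B (1 ⊗ₜ y) = (1 ⊗ₜ y) ⊗ₜ 1 := by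
  simp [baseChangeHom]

/-- The action on `K ⊗ B`, for an algebra `B` over a field of constants of `K` on which the group
scheme acts trivially. -/
def Action.baseChange : Action k H (K ⊗[C] B) :=
  act.ofAdjoin (IsScalarTower.toAlgHom k K (K ⊗[C] B)) (Set.range fun y : B => 1 ⊗ₜ y)
    (baseChangeHom act C hC B) (baseChangeHom_tmul_one act C hC B)
    (by rintro _ ⟨y, rfl⟩; exact baseChangeHom_one_tmul act C hC B y)
    (by
      rw [eq_top_iff]
      rintro z -
      induction z with
      | zero => exact zero_mem _
      | add x y hx hy => exact add_mem hx hy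
      | tmul x y =>
        have hxy : x ⊗ₜ[C] y = (x ⊗ₜ 1) * (1 ⊗ₜ y) := by simp
        rw [hxy]
        exact mul_mem (Algebra.subset_adjoin (Or.inl ⟨x, rfl⟩))
          (Algebra.subset_adjoin (Or.inr ⟨y, rfl⟩)))

end BaseChange

/-! ### Transfer of constant solutions by existential closedness -/

section Formulas

variable {k : Type v} {H : Type w} [Field k] [CommRing H] [HopfAlgebra k H] {n : ℕ}

open FirstOrder Language

/-- The value of a term in a ring with an action. -/
def Action.termRealize {R : Type u} [CommRing R] [Algebra k R] {α : Type*}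
    (act : Action k H R) (b : Module.Basis (Fin (n + 1)) k H)
    (t : (language k n).Term α) (x : α → R) : R :=
  letI := act.toStructure b
  t.realize x

variable (k n) in
/-- Every polynomial over `K` is given by a term. -/
theorem exists_term (K : Type u) [Field K] {m : ℕ} (p : MvPolynomial (Fin m) K) :
    ∃ t : (language k n).Term (K ⊕ Fin m), ∀ (H : Type w) [CommRing H] [HopfAlgebra k H]
      (b : Module.Basis (Fin (n + 1)) k H) (L : Type u) [Field L] [Algebra k L] [Algebra K L]
      (act : Action k H L) (y : Fin m → L),
      act.termRealize b t (Sum.elim (algebraMap K L) y) = MvPolynomial.aeval y p := by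
  induction p using MvPolynomial.induction_on with
  | C a =>
    refine ⟨.var (Sum.inl a), fun H _ _ b L _ _ _ act y => ?_⟩
    simp [Action.termRealize]
  | add p q hp hq =>
    obtain ⟨s, hs⟩ := hp
    obtain ⟨t, ht⟩ := hq
    refine ⟨.func (L := language k n) Func.add ![s, t], fun H _ _ b L _ _ _ act y => ?_⟩
    rw [map_add, ← hs H b L act y, ← ht H b L act y]
    rfl
  | mul_X p i hp =>
    obtain ⟨s, hs⟩ := hp
    refine ⟨.func (L := language k n) Func.mul ![s, .var (Sum.inr i)],
      fun H _ _ b L _ _ _ act y => ?_⟩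
    rw [map_mul, ← hs H b L act y, MvPolynomial.aeval_X]
    rfl

/-- Finitely many quantifier-free conditions have a quantifier-free conjunction. -/
theorem exists_isQF_and {α : Type*} (s : Finset ((language k n).Formula α))
    (hs : ∀ φ ∈ s, φ.IsQF) : ∃ ψ : (language k n).Formula α, ψ.IsQF ∧
      ∀ (R : Type u) [CommRing R] [Algebra k R] (act : Action k H R)
        (b : Module.Basis (Fin (n + 1)) k H) (x : α → R),
        act.Realize b ψ x ↔ ∀ φ ∈ s, act.Realize b φ x := by
  classical
  induction s using Finset.induction_on with
  | empty =>
    refine ⟨⊤, BoundedFormula.IsQF.top, fun R _ _ act b x => ?_⟩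
    simp [Action.Realize]
  | insert φ s hφ ih =>
    obtain ⟨ψ, hψ, h⟩ := ih fun φ' h' => hs φ' (Finset.mem_insert_of_mem h')
    refine ⟨φ ⊓ ψ, (hs φ (Finset.mem_insert_self _ _)).inf hψ, fun R _ _ act b x => ?_⟩
    rw [Finset.forall_mem_insert, ← h]
    simp [Action.Realize]

/-- Makes constancy expressible without a symbol for ∂₀: the counit law forces ∂₀ x = x, and 1 has
b₀-coordinate 1, so the 0-th coordinates agree automatically. As b₀ need not be 1, the other
coordinates of 1 appear as coefficients. -/
theorem hom_eq_tmul_one_iff {R : Type u} [CommRing R] [Algebra k R] (act : Action k H R)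
    (b : Module.Basis (Fin (n + 1)) k H) (hb_zero : Coalgebra.counit (R := k) (b 0) = 1)
    (hb_succ : ∀ i : Fin n, Coalgebra.counit (R := k) (b i.succ) = 0) (x : R) :
    act.hom x = x ⊗ₜ 1 ↔
      ∀ i : Fin n, act.op b i.succ x = algebraMap k R (b.repr 1 i.succ) * x := by
  have hop : ∀ i, (Algebra.TensorProduct.basis R b).repr (x ⊗ₜ[k] (1 : H)) i =
      algebraMap k R (b.repr 1 i) * x := fun i => by
    simp [Algebra.TensorProduct.basis_repr_tmul, mul_comm]
  have h0 : act.op b 0 x = x := by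
    have h := DFunLike.congr_fun act.counit_comp x
    rw [AlgHom.comp_apply, ← (Algebra.TensorProduct.basis R b).sum_repr (act.hom x),
      Fin.sum_univ_succ] at h
    simpa [hb_zero, hb_succ, TensorProduct.smul_tmul', Action.op] using h
  have h1 : b.repr 1 0 = 1 := by
    have h := Bialgebra.counit_one (R := k) (A := H)
    rw [← b.sum_repr 1, Fin.sum_univ_succ] at h
    simpa [hb_zero, hb_succ] using h
  constructor
  · intro h i
    rw [Action.op, h, hop]
  · intro h
    refine (Algebra.TensorProduct.basis R b).ext_elem fun i => ?_
    rw [hop]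
    refine Fin.cases ?_ (fun i => h i) i
    rw [h1, map_one, one_mul]
    exact h0

/-- In an existentially closed field, a system of polynomial equations over the constants has a
constant solution if it has one in some extension. -/
theorem exists_constant_solution {K : Type u} [Field K] [Algebra k K] {act : Action k H K}
    (b : Module.Basis (Fin (n + 1)) k H) (hb_zero : Coalgebra.counit (R := k) (b 0) = 1)
    (hb_succ : ∀ i : Fin n, Coalgebra.counit (R := k) (b i.succ) = 0)
    (hK : IsExistentiallyClosed act b) (L : Type u) [Field L] [Algebra k L] [Algebra K L]
    [IsScalarTower k K L] (actL : Action k H L) (hL : IsExtension act actL) {m : ℕ}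
    (s : Finset (MvPolynomial (Fin m) K)) (y : Fin m → L)
    (hs : ∀ p ∈ s, MvPolynomial.aeval y p = 0) (hy : ∀ i, actL.hom (y i) = y i ⊗ₜ 1) :
    ∃ x : Fin m → K, (∀ p ∈ s, MvPolynomial.eval x p = 0) ∧ ∀ i, act.hom (x i) = x i ⊗ₜ 1 := by
  classical
  choose t ht using exists_term.{u, v, w} k n K (m := m)
  let zero : (language k n).Term (K ⊕ Fin m) := .func (L := language k n) Func.zero ![]
  let f : MvPolynomial (Fin m) K → (language k n).Formula (K ⊕ Fin m) := fun p =>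
    (t p).equal zero
  let g : Fin m × Fin n → (language k n).Formula (K ⊕ Fin m) := fun q =>
    Term.equal (.func (L := language k n) (Func.op q.2) ![.var (Sum.inr q.1)])
      (.func (L := language k n) Func.mul
        ![.func (L := language k n) (Func.const (b.repr 1 q.2.succ)) ![], .var (Sum.inr q.1)])
  obtain ⟨ψ, hψ, h⟩ := exists_isQF_and.{u, v, w} (H := H) (s.image f ∪ Finset.univ.image g) (by
    intro φ hφ
    rw [Finset.mem_union, Finset.mem_image, Finset.mem_image] at hφ
    rcases hφ with ⟨p, -, rfl⟩ | ⟨q, -, rfl⟩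
    · exact (BoundedFormula.IsAtomic.equal _ _).isQF
    · exact (BoundedFormula.IsAtomic.equal _ _).isQF)
  -- The terms do not depend on the field, so one formula has this meaning in both L and K.
  have key : ∀ (F : Type u) [Field F] [Algebra k F] [Algebra K F] (actF : Action k H F)
      (z : Fin m → F), actF.Realize b ψ (Sum.elim (algebraMap K F) z) ↔
        (∀ p ∈ s, MvPolynomial.aeval z p = 0) ∧ ∀ i, actF.hom (z i) = z i ⊗ₜ 1 := by
    intro F _ _ _ actF z
    rw [h]
    have hf : ∀ p, actF.Realize b (f p) (Sum.elim (algebraMap K F) z) ↔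
        MvPolynomial.aeval z p = 0 := by
      intro p
      rw [← ht p H b F actF z]
      let := actF.toStructure b
      exact Formula.realize_equal
    have hg : ∀ q, actF.Realize b (g q) (Sum.elim (algebraMap K F) z) ↔
        actF.op b q.2.succ (z q.1) = algebraMap k F (b.repr 1 q.2.succ) * z q.1 := by
      intro q
      let := actF.toStructure b
      exact Formula.realize_equal
    simp only [hom_eq_tmul_one_iff actF b hb_zero hb_succ]
    constructor
    · intro hφ
      exact ⟨fun p hp => (hf p).mp (hφ _ (Finset.mem_union_left _ (Finset.mem_image_of_mem f hp))),
        fun i j => (hg (i, j)).mp (hφ _ (Finset.mem_union_right _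
          (Finset.mem_image_of_mem g (Finset.mem_univ (i, j)))))⟩
    · rintro ⟨h1, h2⟩ φ hφ
      rw [Finset.mem_union, Finset.mem_image, Finset.mem_image] at hφ
      rcases hφ with ⟨p, hp, rfl⟩ | ⟨q, -, rfl⟩
      · exact (hf p).mpr (h1 p hp)
      · exact (hg q).mpr (h2 q.1 q.2)
  obtain ⟨x, hx⟩ := hK L actL hL m ψ hψ ⟨y, (key L actL y).mpr ⟨hs, hy⟩⟩
  have := (key K act x).mp hx
  exact ⟨x, fun p hp => by simpa [MvPolynomial.aeval_eq_eval] using this.1 p hp, this.2⟩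

/-- A system of equations over the constants of an existentially closed field `K` has a constant
solution if it has one in an algebra `B` for which `K ⊗ B` is a field. -/
theorem exists_solution_of_isField_tensorProduct {K : Type u} [Field K] [Algebra k K]
    {act : Action k H K} (b : Module.Basis (Fin (n + 1)) k H)
    (hb_zero : Coalgebra.counit (R := k) (b 0) = 1)
    (hb_succ : ∀ i : Fin n, Coalgebra.counit (R := k) (b i.succ) = 0)
    (hK : IsExistentiallyClosed act b) (B : Type u) [CommRing B] [Algebra (constants act) B]
    (hB : IsField (K ⊗[constants act] B)) {m : ℕ} (I : Ideal (MvPolynomial (Fin m) (constants act)))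
    (y : Fin m → B) (hy : ∀ p ∈ I, MvPolynomial.aeval y p = 0) :
    ∃ x : Fin m → constants act, ∀ p ∈ I, MvPolynomial.eval x p = 0 := by
  classical
  -- A formula holds only finitely many equations, so generators of `I` are used.
  obtain ⟨s, hs⟩ := (isNoetherianRing_iff_ideal_fg _).mp inferInstance I
  let := hB.toField
  let actL : Action k H (K ⊗[constants act] B) :=
    act.baseChange (constants act) (fun c => c.2) B
  obtain ⟨x, hx, hx'⟩ := exists_constant_solution b hb_zero hb_succ hK (K ⊗[constants act] B) actL
    (baseChangeHom_tmul_one act (constants act) _ B)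
    (s.image (MvPolynomial.map (algebraMap (constants act) K))) (fun i => 1 ⊗ₜ y i)
    (by
      intro p hp
      obtain ⟨q, hq, rfl⟩ := Finset.mem_image.mp hp
      have hq' : MvPolynomial.aeval y q = 0 := hy q (hs ▸ Ideal.subset_span hq)
      rw [MvPolynomial.aeval_map_algebraMap]
      have := congrArg (Algebra.TensorProduct.includeRight :
        B →ₐ[constants act] K ⊗[constants act] B) hq'
      rwa [map_zero, ← AlgHom.comp_apply, MvPolynomial.comp_aeval] at this)
    (fun i => baseChangeHom_one_tmul act (constants act) _ B (y i))
  let x' : Fin m → constants act := fun i => ⟨x i, hx' i⟩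
  refine ⟨x', fun p hp => ?_⟩
  have : I ≤ RingHom.ker (MvPolynomial.eval x') := by
    rw [← hs, Ideal.span_le]
    intro q hq
    have := hx _ (Finset.mem_image_of_mem _ hq)
    rw [MvPolynomial.eval_map] at this
    apply (algebraMap (constants act) K).injective
    rw [map_zero, ← this, MvPolynomial.eval, MvPolynomial.coe_eval₂Hom, MvPolynomial.eval₂_comp_left]
    rfl
  exact this hp

end Formulas

/-! ### Function fields of absolutely irreducible varieties -/

section AbsolutelyIrreducible

variable {M : Type u} [Field M] {m : ℕ}

theorem isDomain_tensorProduct_quotient {F : Type*} [Field F] [Algebra M F]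
    (I : Ideal (MvPolynomial (Fin m) M))
    (hI : (I.map (MvPolynomial.map (σ := Fin m) (algebraMap M F))).IsPrime) :
    IsDomain (F ⊗[M] (MvPolynomial (Fin m) M ⧸ I)) := by
  let e := Algebra.TensorProduct.tensorQuotientEquiv (R := M) M (MvPolynomial (Fin m) M) F I
  let f := MvPolynomial.algebraTensorAlgEquiv (σ := Fin m) M F
  have hJ : (I.map (Algebra.TensorProduct.includeRight :
      MvPolynomial (Fin m) M →ₐ[M] F ⊗[M] MvPolynomial (Fin m) M)).IsPrime := by
    have h1 : I.map (Algebra.TensorProduct.includeRight :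
        MvPolynomial (Fin m) M →ₐ[M] F ⊗[M] MvPolynomial (Fin m) M) =
        (I.map (MvPolynomial.map (σ := Fin m) (algebraMap M F))).map f.symm.toRingEquiv := by
      have : (Algebra.TensorProduct.includeRight :
        MvPolynomial (Fin m) M →ₐ[M] F ⊗[M] MvPolynomial (Fin m) M).toRingHom =
        f.symm.toRingEquiv.toRingHom.comp (MvPolynomial.map (σ := Fin m) (algebraMap M F)) :=
        RingHom.ext fun x => (MvPolynomial.algebraTensorAlgEquiv_symm_map M F x).symm
      change I.map (Algebra.TensorProduct.includeRight :
        MvPolynomial (Fin m) M →ₐ[M] F ⊗[M] MvPolynomial (Fin m) M).toRingHom = _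
      rw [this, ← Ideal.map_map]
      rfl
    rw [h1]
    exact Ideal.map_isPrime_of_equiv _
  have := (Ideal.Quotient.isDomain_iff_prime _).mpr hJ
  exact e.toMulEquiv.isDomain _

/-- F ⊗ Frac A is the localization of the domain F ⊗ A at the nonzero elements of A, which stay
nonzero since A embeds in F ⊗ A. -/
theorem isDomain_tensorProduct_fractionRing {F A : Type*} [Field F] [Algebra M F] [CommRing A]
    [IsDomain A] [Algebra M A] [IsDomain (F ⊗[M] A)] : IsDomain (F ⊗[M] FractionRing A) := by
  let g : F ⊗[M] A →ₐ[F] F ⊗[M] FractionRing A :=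
    Algebra.TensorProduct.map (AlgHom.id F F) (IsScalarTower.toAlgHom M A (FractionRing A))
  let : Algebra (F ⊗[M] A) (F ⊗[M] FractionRing A) := g.toRingHom.toAlgebra
  have : IsScalarTower F (F ⊗[M] A) (F ⊗[M] FractionRing A) :=
    .of_algebraMap_eq' g.comp_algebraMap.symm
  have hloc := IsLocalization.tensorProduct_tensorProduct_right M F (nonZeroDivisors A)
    (FractionRing A) (by ext x; simp [RingHom.algebraMap_toAlgebra, g])
  refine IsLocalization.isDomain_of_le_nonZeroDivisors (R := F ⊗[M] A) (F ⊗[M] FractionRing A)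
    (M := (nonZeroDivisors A).map (Algebra.TensorProduct.includeRight : A →ₐ[M] F ⊗[M] A)) ?_
  rintro _ ⟨x, hx, rfl⟩
  refine mem_nonZeroDivisors_of_ne_zero fun h => nonZeroDivisors.ne_zero hx ?_
  refine Algebra.TensorProduct.includeRight_injective (algebraMap M F).injective ?_
  rw [map_zero]
  exact h

theorem isDomain_tensorProduct_of_algHom {F F' B : Type*} [Field F] [Algebra M F] [Field F']
    [Algebra M F'] [CommRing B] [Algebra M B] (f : F →ₐ[M] F') [IsDomain (F' ⊗[M] B)] :
    IsDomain (F ⊗[M] B) :=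
  Function.Injective.isDomain (Algebra.TensorProduct.map f (AlgHom.id M B)).toRingHom
    (Module.Flat.rTensor_preserves_injective_linearMap (M := B) f.toLinearMap f.injective)

theorem isDomain_of_isDomain_tensorProduct {F A : Type*} [Field F] [Algebra M F] [CommRing A]
    [Algebra M A] [IsDomain (F ⊗[M] A)] : IsDomain A :=
  Function.Injective.isDomain (Algebra.TensorProduct.includeRight : A →ₐ[M] F ⊗[M] A).toRingHom
    (Algebra.TensorProduct.includeRight_injective (algebraMap M F).injective)

/-- The function field of an absolutely irreducible variety over `M` is a field extension `B` with
a point such that `K ⊗ B` is a field for each algebraic extension `K` of `M`. -/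
theorem exists_isField_tensorProduct (K : Type*) [Field K] [Algebra M K] [Algebra.IsAlgebraic M K]
    (I : Ideal (MvPolynomial (Fin m) M))
    (hI : (I.map (MvPolynomial.map (σ := Fin m) (algebraMap M (AlgebraicClosure M)))).IsPrime) :
    ∃ (B : Type u) (_ : CommRing B) (_ : Algebra M B) (y : Fin m → B),
      IsField (K ⊗[M] B) ∧ ∀ p ∈ I, MvPolynomial.aeval y p = 0 := by
  have := isDomain_tensorProduct_quotient I hI
  have := isDomain_of_isDomain_tensorProduct (M := M) (F := AlgebraicClosure M)
    (A := MvPolynomial (Fin m) M ⧸ I)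
  have := isDomain_tensorProduct_fractionRing (M := M) (F := AlgebraicClosure M)
    (A := MvPolynomial (Fin m) M ⧸ I)
  let B := FractionRing (MvPolynomial (Fin m) M ⧸ I)
  have : IsDomain (K ⊗[M] B) :=
    isDomain_tensorProduct_of_algHom (IsAlgClosed.lift : K →ₐ[M] AlgebraicClosure M)
  refine ⟨B, inferInstance, inferInstance, fun i => algebraMap _ B (Ideal.Quotient.mk I (.X i)),
    Algebra.TensorProduct.isField_of_isAlgebraic _ _ _ (Or.inl inferInstance), fun p hp => ?_⟩
  have h : (MvPolynomial.aeval fun i => algebraMap _ B (Ideal.Quotient.mk I (.X i))) =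
      (IsScalarTower.toAlgHom M (MvPolynomial (Fin m) M ⧸ I) B).comp
        (Ideal.Quotient.mkₐ M I) := by
    ext i
    simp
  rw [h, AlgHom.comp_apply, Ideal.Quotient.mkₐ_eq_mk, Ideal.Quotient.eq_zero_iff_mem.mpr hp,
    map_zero]

end AbsolutelyIrreducible

theorem isPAC_constants {k : Type v} {H : Type w} [Field k] [CommRing H] [HopfAlgebra k H]
    [Module.Finite k H] {n : ℕ} (b : Module.Basis (Fin (n + 1)) k H)
    (hb_zero : Coalgebra.counit (R := k) (b 0) = 1)
    (hb_succ : ∀ i : Fin n, Coalgebra.counit (R := k) (b i.succ) = 0)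
    {K : Type u} [Field K] [Algebra k K] (act : Action k H K)
    (hK : IsExistentiallyClosed act b) : IsPAC (constants act) := by
  intro m I hI
  have := finiteDimensional_constants act
  obtain ⟨B, _, _, y, hB, hy⟩ := exists_isField_tensorProduct K I hI
  exact exists_solution_of_isField_tensorProduct b hb_zero hb_succ hK B hB I y hy

/-! ### Topologically finitely generated groups are small -/

section Small

/-- A topological group with a finite subset that generates a dense subgroup is small. -/
theorem isSmall_of_dense_closure {G : Type u} [Group G] [TopologicalSpace G]
    [IsTopologicalGroup G] {T : Set G} (hT : T.Finite)
    (hd : Dense (Subgroup.closure T : Set G)) : IsSmall G := by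
  intro n hn
  have hfin := hT.to_subtype
  -- Cosets are numbered with the trivial one as 0, so that U is the stabilizer of 0 in the
  -- resulting action on `Fin n`. There are finitely many choices for the action of the finite set
  -- `T`.
  have : ∀ U : {U : Subgroup G | IsOpen (U : Set G) ∧ U.index = n},
      ∃ f : (G ⧸ U.1) ≃ Fin n, f (1 : G) = ⟨0, hn⟩ := by
    rintro ⟨U, hU, rfl⟩
    have : Finite (G ⧸ U) := (Subgroup.finiteIndex_iff_finite_quotient).mp ⟨hn.ne'⟩
    let f : (G ⧸ U) ≃ Fin U.index := Finite.equivFin _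
    exact ⟨f.trans (Equiv.swap (f (1 : G)) ⟨0, hn⟩), by simp⟩
  choose f hf using this
  let F : {U : Subgroup G | IsOpen (U : Set G) ∧ U.index = n} → T → Equiv.Perm (Fin n) :=
    fun U t => (f U).permCongr (MulAction.toPerm (t : G))
  rw [← Set.finite_coe_iff]
  refine Finite.of_injective F fun U V hUV => ?_
  let ρ : ∀ U : {U : Subgroup G | IsOpen (U : Set G) ∧ U.index = n}, G →* Equiv.Perm (Fin n) :=
    fun U => (f U).permCongrHom.toMonoidHom.comp (MulAction.toPermHom G (G ⧸ U.1))
  have hρ : ∀ g ∈ Subgroup.closure T, ρ U g = ρ V g := by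
    have : Set.EqOn (ρ U) (ρ V) (Subgroup.closure T) :=
      MonoidHom.eqOn_closure fun t ht => congrFun hUV ⟨t, ht⟩
    exact this
  have hmem : ∀ W : {U : Subgroup G | IsOpen (U : Set G) ∧ U.index = n}, ∀ g : G,
      g ∈ W.1 ↔ ρ W g ⟨0, hn⟩ = ⟨0, hn⟩ := by
    intro W g
    have h : ρ W g ⟨0, hn⟩ = f W (g : G) := by
      change f W (g • (f W).symm ⟨0, hn⟩) = _
      rw [← hf W, Equiv.symm_apply_apply, MulAction.Quotient.smul_coe, smul_eq_mul, mul_one]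
    rw [h, ← hf W, (f W).injective.eq_iff, eq_comm, QuotientGroup.eq]
    simp
  have hle : ∀ V W : {U : Subgroup G | IsOpen (U : Set G) ∧ U.index = n},
      (∀ g ∈ Subgroup.closure T, ρ V g = ρ W g) → V.1 ≤ W.1 := by
    intro V W h g hg
    have hWc : IsClosed (W.1 : Set G) := Subgroup.isClosed_of_isOpen _ W.2.1
    -- Agreement on the dense subgroup suffices: V is open, so its dense part is dense in V, and W
    -- is closed.
    have h1 : (V.1 : Set G) ⊆ closure (V.1 ∩ Subgroup.closure T) :=
      hd.open_subset_closure_inter V.2.1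
    refine hWc.closure_subset_iff.mpr ?_ (h1 hg)
    rintro x ⟨hx, hx'⟩
    exact (hmem W x).mpr (h x hx' ▸ (hmem V x).mp hx)
  exact Subtype.ext (le_antisymm (hle U V hρ) (hle V U fun g hg => (hρ g hg).symm))

end Small

/-! ### Boundedness from irreducible polynomials -/

section Galois

variable {M : Type u} [Field M]

/-- Adjoining a root of a polynomial commutes with extension of scalars. -/
def tensorAdjoinRootEquiv (F : Type*) [Field F] [Algebra M F] (f : Polynomial M) :
    F ⊗[M] AdjoinRoot f ≃+* AdjoinRoot (f.map (algebraMap M F)) :=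
  (AdjoinRoot.tensorAlgEquiv (R := M) (T := F) f _ rfl).toRingEquiv.trans
    (AdjoinRoot.mapRingEquiv (Algebra.TensorProduct.rid M M F).toRingEquiv _ _ (by
      have h : RingHom.comp (Algebra.TensorProduct.rid M M F).toRingEquiv
          (Algebra.TensorProduct.includeRight : M →ₐ[M] F ⊗[M] M).toRingHom = algebraMap M F :=
        RingHom.ext fun x => by simp [Algebra.algebraMap_eq_smul_one]
      rw [Polynomial.map_map, h]))

/-- If `α` generates an extension that meets a finite Galois extension trivially, the minimal
polynomial of `α` remains irreducible over that extension. -/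
theorem irreducible_map_minpoly {S : Type*} [Field S] [Algebra M S] (N : IntermediateField M S)
    [IsGalois M N] [FiniteDimensional M N] (α : S) (hα : IsIntegral M α)
    (h : N ⊓ IntermediateField.adjoin M {α} = ⊥) :
    Irreducible ((minpoly M α).map (algebraMap M N)) := by
  have := IntermediateField.adjoin.finiteDimensional hα
  -- Since N is Galois, trivial intersection gives linear disjointness, so N ⊗ M(α) ≅ N[X]/(minpoly)
  -- is a domain.
  have hd := (IntermediateField.LinearDisjoint.of_inf_eq_bot h).isDomain
  have : IsDomain (AdjoinRoot ((minpoly M α).map (algebraMap M N))) :=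
    ((tensorAdjoinRootEquiv N (minpoly M α)).symm.trans (Algebra.TensorProduct.congr
      (AlgEquiv.refl (A₁ := N) (R := M))
      (IntermediateField.adjoinRootEquivAdjoin M hα)).toRingEquiv).toMulEquiv.isDomain _
  have hne : (minpoly M α).map (algebraMap M N) ≠ 0 :=
    ((minpoly.monic hα).map _).ne_zero
  exact ((Ideal.span_singleton_prime hne).mp
    ((Ideal.Quotient.isDomain_iff_prime _).mp this)).irreducible

/-- Let `K` be a finite extension of `M` such that each irreducible separable polynomial over `M`
that remains irreducible over `K` is linear. Then `M` is bounded. -/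
theorem isBoundedField_of_irreducible (K : Type*) [Field K] [Algebra M K] [FiniteDimensional M K]
    (hK : ∀ f : Polynomial M, f.Monic → Irreducible f → f.Separable →
      Irreducible (f.map (algebraMap M K)) → ∃ x, f.IsRoot x) : IsBoundedField M := by
  let S := SeparableClosure M
  let Ks := separableClosure M K
  let j : Ks →ₐ[M] S := IsSepClosed.lift
  let N : IntermediateField M S := IntermediateField.normalClosure M j.fieldRange S
  have : FiniteDimensional M j.fieldRange := 
    j.toLinearMap.finiteDimensional_range
  have : FiniteDimensional M N := inferInstance
  have : IsGalois M N := {}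
  have hirr : ∀ α : S, N ⊓ IntermediateField.adjoin M {α} = ⊥ →
      α ∈ (⊥ : IntermediateField M S) := by
    intro α hα
    have hint : IsIntegral M α := Algebra.IsIntegral.isIntegral α
    have hsep : IsSeparable M α := Algebra.IsSeparable.isSeparable M α
    have h1 := irreducible_map_minpoly N α hint hα
    let j' : Ks →ₐ[M] N := (IntermediateField.inclusion
      (IntermediateField.le_normalClosure j.fieldRange)).comp j.rangeRestrict
    have h2 : Irreducible ((minpoly M α).map (algebraMap M Ks)) := by
      refine ((minpoly.monic hint).map _).irreducible_of_irreducible_map (j' : Ks →+* N) _ ?_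
      rw [Polynomial.map_map]
      rwa [j'.comp_algebraMap]
    -- K is purely inseparable over `Ks`, and a separable irreducible polynomial stays irreducible
    -- over such an extension.
    have h3 : Irreducible ((minpoly M α).map (algebraMap M K)) := by
      let f := (minpoly M α).map (algebraMap M Ks)
      obtain ⟨β, hβ⟩ := IsAlgClosed.exists_aeval_eq_zero (AlgebraicClosure K) f
        h2.degree_pos.ne'
      have hf : f = minpoly Ks β :=
        minpoly.eq_of_irreducible_of_monic h2 hβ ((minpoly.monic hint).map _)
      have hs : IsSeparable Ks β := by
        rw [IsSeparable, ← hf]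
        exact Polynomial.Separable.map hsep
      have := minpoly.map_eq_of_isSeparable_of_isPurelyInseparable K β hs
      rw [← hf, Polynomial.map_map, ← IsScalarTower.algebraMap_eq] at this
      rw [this]
      exact minpoly.irreducible (IsIntegral.tower_top (R := Ks) hs.isIntegral)
    obtain ⟨x, hx⟩ := hK _ (minpoly.monic hint) (minpoly.irreducible hint) hsep h3
    exact IntermediateField.mem_bot.mpr (minpoly.mem_range_of_degree_eq_one M α
      (Polynomial.degree_eq_one_of_irreducible_of_root (minpoly.irreducible hint) hx))
  let Γ := S ≃ₐ[M] S
  let U : Subgroup Γ := N.fixingSubgroup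
  have hU : Finite (Γ ⧸ U) :=
    Subgroup.quotient_finite_of_isOpen U (IntermediateField.fixingSubgroup_isOpen N)
  let T : Set Γ := Set.range (Quotient.out : Γ ⧸ U → Γ)
  refine isSmall_of_dense_closure (Set.finite_range _ : T.Finite) ?_
  have hTU : ∀ σ : Γ, ∃ t ∈ T, ∃ τ ∈ U, t * τ = σ := fun σ =>
    ⟨_, ⟨(σ : Γ ⧸ U), rfl⟩, (Quotient.out (σ : Γ ⧸ U))⁻¹ * σ,
      QuotientGroup.eq.mp (Quotient.out_eq' _), by simp⟩
  let D : ClosedSubgroup Γ := ⟨(Subgroup.closure T).topologicalClosure,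
    Subgroup.isClosed_topologicalClosure _⟩
  have hD : IntermediateField.fixedField D.1 = ⊥ := by
    rw [eq_bot_iff]
    intro α hα
    -- An element of N ∩ M(α) is fixed by `T` and by `U`, hence by every product, that is, by all of
    -- Γ.
    apply hirr
    rw [eq_bot_iff]
    intro x hx
    rw [InfiniteGalois.mem_bot_iff_fixed]
    intro σ
    obtain ⟨t, ht, τ, hτ, rfl⟩ := hTU σ
    have h1 : τ x = x := (IntermediateField.mem_fixingSubgroup_iff _ _).mp hτ x hx.1
    have h2 : x ∈ IntermediateField.fixedField D.1 :=
      (IntermediateField.adjoin_simple_le_iff.mpr hα) hx.2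
    rw [AlgEquiv.mul_apply, h1]
    exact h2 ⟨t, Subgroup.le_topologicalClosure _ (Subgroup.subset_closure ht)⟩
  have h := InfiniteGalois.fixingSubgroup_fixedField D
  rw [hD, IntermediateField.fixingSubgroup_bot] at h
  intro σ
  have : σ ∈ D.1 := h ▸ Subgroup.mem_top σ
  exact this

end Galois

theorem isBoundedField_constants {k : Type v} {H : Type w} [Field k] [CommRing H] [HopfAlgebra k H]
    [Module.Finite k H] {n : ℕ} (b : Module.Basis (Fin (n + 1)) k H)
    (hb_zero : Coalgebra.counit (R := k) (b 0) = 1)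
    (hb_succ : ∀ i : Fin n, Coalgebra.counit (R := k) (b i.succ) = 0)
    {K : Type u} [Field K] [Algebra k K] (act : Action k H K)
    (hK : IsExistentiallyClosed act b) : IsBoundedField (constants act) := by
  have := finiteDimensional_constants act
  refine isBoundedField_of_irreducible K fun f hf hirr hsep hmap => ?_
  have := Fact.mk hmap
  -- The tensor product is K[X]/(f), a field because f is irreducible over K.
  have hB : IsField (K ⊗[constants act] AdjoinRoot f) := 
    (tensorAdjoinRootEquiv K f).toMulEquiv.isField (Field.toIsField _)
  let p : MvPolynomial (Fin 1) (constants act) := Polynomial.aeval (.X 0) f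
  have hp : ∀ (R : Type u) [CommRing R] [Algebra (constants act) R] (y : Fin 1 → R),
      MvPolynomial.aeval y p = Polynomial.aeval (y 0) f := by
    intro R _ _ y
    rw [← Polynomial.aeval_algHom_apply, MvPolynomial.aeval_X]
  obtain ⟨x, hx⟩ := exists_solution_of_isField_tensorProduct b hb_zero hb_succ hK (AdjoinRoot f) hB
    (Ideal.span {p}) (fun _ => AdjoinRoot.root f) (by
      change Ideal.span {p} ≤ RingHom.ker _
      rw [Ideal.span_singleton_le_iff_mem, RingHom.mem_ker, hp, AdjoinRoot.aeval_eq,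
        AdjoinRoot.mk_self])
  refine ⟨x 0, ?_⟩
  have := hx p (Ideal.mem_span_singleton_self p)
  rwa [← MvPolynomial.aeval_eq_eval, hp, Polynomial.coe_aeval_eq_eval] at this

end

end FiniteGroupScheme

theorem corollary4p10 {k : Type v} {H : Type w} [Field k] [CommRing H] [HopfAlgebra k H]
    [Module.Finite k H] {n : ℕ} (b : Module.Basis (Fin (n + 1)) k H)
    (hb_zero : Coalgebra.counit (R := k) (b 0) = 1)
    (hb_succ : ∀ i : Fin n, Coalgebra.counit (R := k) (b i.succ) = 0)
    {K : Type u} [Field K] [Algebra k K] (act : FiniteGroupScheme.Action k H K)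
    (hK : FiniteGroupScheme.IsExistentiallyClosed act b) :
    FiniteGroupScheme.IsPAC (FiniteGroupScheme.constants act) ∧
      FiniteGroupScheme.IsBoundedField (FiniteGroupScheme.constants act) :=
  ⟨FiniteGroupScheme.isPAC_constants b hb_zero hb_succ act hK,
    FiniteGroupScheme.isBoundedField_constants b hb_zero hb_succ act hK⟩
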